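/- Let $r\ge 2$ and $s\ge 0$ be integers, let $i\in\{-1,0,1\}$, and let $Y=Y^r_s$ be the blowup of $\mathbb P^r$ at $s$ general points. Its group of curve classes $A^{r-1}(Y)$ is free with basis $h$ (the class of a general line) and $e_1,\dots,e_s$ (where $e_j$ is the class of a line in the $j$-th exceptional divisor). A class $c=dh-\sum_j m_je_j$ has degree $\deg(c)=d$. Let $\langle\cdot,\cdot\rangle$ be the symmetric bilinear form on $A^{r-1}(Y)$ given by $\langle h,h\rangle=1$, $\langle h,e_j\rangle=0$, $\langle e_j,e_k\rangle=-(r-1)\delta_{jk}$, and let $F=(r+1)h-\sum_j e_j$. For $I\subset\{1,\dots,s\}$ with $|I|=r+1$, the standard Cremona transformation $\varphi_I$ acts on $A^{r-1}(Y)$ by sending $dh-\sum_j m_je_j$ to $d'h-\sum_j m_j'e_j$, where, with $t=d-\sum_{j\in I}m_j$, one has $d'=d+(r-1)t$, $m_j'=m_j+t$ for $j\in I$, and $m_j'=m_j$ for $j\notin I$. The Weyl group $W$ is the group of automorphisms of $A^{r-1}(Y)$ generated by the permutations of $e_1,\dots,e_s$ (fixing $h$) and all the $\varphi_I$. An $(i)$-Weyl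 line class is a class in the $W$-orbit of the class of a line through $1-i$ of the points, that is, of a class $h-e_a-e_b$ with $a\ne b$ if $i=-1$, of a class $h-e_a$ if $i=0$, and of $h$ if $i=1$. Every $(i)$-Weyl line class $c\in A^{r-1}(Y)$ is a numerical $(i)$-Weyl line class. That is, (a) $\langle c,F\rangle=2+i(r-1)$; (b) $\langle c,c\rangle=(r-1)(i-1)+1$; (c) (strong projection inequality) for every $w\in W$ with $\deg(w^{-1}(c))>1$ and every $j\in\{1,\dots,s\}$, one has $\langle c,w(h-e_j)\rangle\ge 1$. -/

import Mathlib

namespace WeylLines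

/-- The Chow group `A^{r-1}(Y)` of curve classes of the blowup `Y` of `ℙ^r` at `s` general points:
the free abelian group with basis `h` (the general line) and `e_1, …, e_s` (the lines in the
exceptional divisors).  The pair `(d, m)` stands for the class `d h - ∑ i, m_i e_i`, of degree `d`
and with multiplicities `m_i`. -/
abbrev CurveClass (s : ℕ) : Type := ℤ × (Fin s → ℤ)

/-- The degree `d` of the class `d h - ∑ i, m_i e_i`. -/
def deg {s : ℕ} (c : CurveClass s) : ℤ := c.1

/-- The multiplicity `m_i` of the class `d h - ∑ i, m_i e_i`. -/
def mult {s : ℕ} (c : CurveClass s) (i : Fin s) : ℤ := c.2 i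

/-- The class `h` of a general line. -/
def h (s : ℕ) : CurveClass s := (1, 0)

/-- The class `e_j` of a line in the `j`-th exceptional divisor. -/
def e {s : ℕ} (j : Fin s) : CurveClass s := (0, -Pi.single j 1)

/-- A class is `d h - ∑ i, m_i e_i`, where `d` is its degree and the `m_i` its multiplicities. -/
theorem eq_deg_smul_sub_sum {s : ℕ} (c : CurveClass s) :
    c = deg c • h s - ∑ i, mult c i • e i := by
  ext j
  · simp [deg, h, e, Prod.fst_sum]
  · simp [mult, h, e, Prod.snd_sum, Finset.sum_apply, Pi.single_apply]

/-- The anticanonical curve class `F = (r+1) h - ∑ i, e_i`. -/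
def F (r s : ℕ) : CurveClass s := ((r : ℤ) + 1) • h s - ∑ i, e i

/-- The quadratic form `q(d h - ∑ i, m_i e_i) = d² - (r-1) ∑ i, m_i²`. -/
def q (r : ℕ) {s : ℕ} (c : CurveClass s) : ℤ :=
  deg c ^ 2 - ((r : ℤ) - 1) * ∑ i, mult c i ^ 2

/-- The symmetric bilinear form `⟨x, y⟩` associated with `q`. -/
def bilin (r : ℕ) {s : ℕ} (x y : CurveClass s) : ℤ :=
  deg x * deg y - ((r : ℤ) - 1) * ∑ i, mult x i * mult y i

/-- `bilin` is the polarization of `q`, that is, `⟨x, y⟩ = (q(x+y) - q(x) - q(y)) / 2`. -/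
theorem two_mul_bilin (r : ℕ) {s : ℕ} (x y : CurveClass s) :
    2 * bilin r x y = q r (x + y) - q r x - q r y := by
  have key : ∑ i, mult (x + y) i ^ 2
      = ∑ i, mult x i ^ 2 + 2 * ∑ i, mult x i * mult y i + ∑ i, mult y i ^ 2 := by
    rw [Finset.mul_sum, ← Finset.sum_add_distrib, ← Finset.sum_add_distrib]
    refine Finset.sum_congr rfl fun i _ => ?_
    simp only [mult, Prod.snd_add, Pi.add_apply]
    ring
  have hd : deg (x + y) = deg x + deg y := rfl
  simp only [q, bilin, key, hd]
  ring

/-- The action of a permutation of the `s` points on curve classes: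
`h ↦ h` and `e_j ↦ e_{σ j}`. -/
def permAct {s : ℕ} (σ : Equiv.Perm (Fin s)) : CurveClass s ≃ₗ[ℤ] CurveClass s :=
  LinearEquiv.prodCongr (LinearEquiv.refl ℤ ℤ) (LinearEquiv.funCongrLeft ℤ ℤ σ.symm)

/-- The formula for the standard Cremona transformation based at the points of `I`:
with `t = d - ∑ i ∈ I, m_i`, the degree becomes `d + (r-1) t`, the multiplicity `m_i` becomes
`m_i + t` for `i ∈ I` and is unchanged for `i ∉ I`. -/
def cremonaMap (r : ℕ) {s : ℕ} (I : Finset (Fin s)) : CurveClass s →ₗ[ℤ] CurveClass s where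
  toFun c :=
    (deg c + ((r : ℤ) - 1) * (deg c - ∑ i ∈ I, mult c i),
      fun i => if i ∈ I then mult c i + (deg c - ∑ k ∈ I, mult c k) else mult c i)
  map_add' x y := by
    ext j
    · simp only [deg, mult, Prod.fst_add, Prod.snd_add, Pi.add_apply, Finset.sum_add_distrib]
      ring
    · simp only [deg, mult, Prod.fst_add, Prod.snd_add, Pi.add_apply, Finset.sum_add_distrib]
      split_ifs <;> ring
  map_smul' a x := by
    ext j
    · simp only [deg, mult, Prod.smul_fst, Prod.smul_snd, Pi.smul_apply, smul_eq_mul,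
        ← Finset.mul_sum, RingHom.id_apply]
      ring
    · simp only [deg, mult, Prod.smul_fst, Prod.smul_snd, Pi.smul_apply, smul_eq_mul,
        ← Finset.mul_sum, RingHom.id_apply]
      split_ifs <;> ring

theorem cremonaMap_involutive (r : ℕ) {s : ℕ} (I : Finset (Fin s)) (hI : I.card = r + 1) :
    Function.Involutive (cremonaMap r I) := by
  intro c
  have key : ∑ k ∈ I, mult (cremonaMap r I c) k
      = ∑ k ∈ I, mult c k + ((r : ℤ) + 1) * (deg c - ∑ k ∈ I, mult c k) := by
    have h1 : ∀ k ∈ I, mult (cremonaMap r I c) k = mult c k + (deg c - ∑ k ∈ I, mult c k) :=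
      fun k hk => if_pos hk
    rw [Finset.sum_congr rfl h1, Finset.sum_add_distrib, Finset.sum_const, hI]
    simp
  have hd : deg (cremonaMap r I c)
      = deg c + ((r : ℤ) - 1) * (deg c - ∑ i ∈ I, mult c i) := rfl
  ext j
  · change deg (cremonaMap r I c)
      + ((r : ℤ) - 1) * (deg (cremonaMap r I c) - ∑ i ∈ I, mult (cremonaMap r I c) i) = deg c
    rw [key, hd]
    ring
  · change (if j ∈ I then mult (cremonaMap r I c) j
        + (deg (cremonaMap r I c) - ∑ k ∈ I, mult (cremonaMap r I c) k)
      else mult (cremonaMap r I c) j) = mult c j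
    rw [key, hd]
    by_cases hj : j ∈ I
    · have h2 : mult (cremonaMap r I c) j = mult c j + (deg c - ∑ k ∈ I, mult c k) := if_pos hj
      rw [if_pos hj, h2]
      ring
    · have h2 : mult (cremonaMap r I c) j = mult c j := if_neg hj
      rw [if_neg hj, h2]

/-- The standard Cremona transformation `φ_I` based at a set `I` of `r + 1` of the points, acting on
curve classes. -/
def cremona (r : ℕ) {s : ℕ} (I : Finset (Fin s)) (hI : I.card = r + 1) :
    CurveClass s ≃ₗ[ℤ] CurveClass s :=
  LinearEquiv.ofInvolutive (cremonaMap r I) (cremonaMap_involutive r I hI)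

/-- The Weyl group acting on curve classes: it is generated by the permutations of the `s` points
and the standard Cremona transformations `φ_I`, `|I| = r + 1`.
(If `s ≤ r`, there are no Cremona transformations.) -/
def weylGroup (r s : ℕ) : Subgroup (CurveClass s ≃ₗ[ℤ] CurveClass s) :=
  Subgroup.closure
    (Set.range permAct ∪ {g | ∃ (I : Finset (Fin s)) (hI : I.card = r + 1), g = cremona r I hI})

/-- The class `h - ∑ j ∈ T, e_j` of a line through the points indexed by `T`. -/
def lineThrough {s : ℕ} (T : Finset (Fin s)) : CurveClass s := h s - ∑ j ∈ T, e j

/-- `c` is an `(i)`-Weyl line class: it lies in the orbit, under the Weyl group, of the class of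
a line through `1 - i` of the points. -/
def IsWeylLineClass (r s : ℕ) (i : ℤ) (c : CurveClass s) : Prop :=
  ∃ T : Finset (Fin s), (T.card : ℤ) = 1 - i ∧ ∃ w ∈ weylGroup r s, c = w (lineThrough T)

/-- The strong projection inequality. -/
def StrongProjectionInequality (r s : ℕ) (c : CurveClass s) : Prop :=
  ∀ w ∈ weylGroup r s, 1 < deg (w⁻¹ c) → ∀ j : Fin s, 1 ≤ bilin r c (w (h s - e j))

/-- `c` is a numerical `(i)`-Weyl line class. -/
structure IsNumericalWeylLineClass (r s : ℕ) (i : ℤ) (c : CurveClass s) : Prop where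
  linear : bilin r c (F r s) = 2 + i * ((r : ℤ) - 1)
  quadratic : bilin r c c = ((r : ℤ) - 1) * (i - 1) + 1
  strong : StrongProjectionInequality r s c

end WeylLines

/-! The linear and quadratic conditions hold because `W` preserves `bilin` and fixes `F`. By the
same invariance, the projection inequality for `c` and `w` is the inequality `(r-1) m_j < d` for the
Weyl line class `w⁻¹ c` of degree `d > 1` (`IsWeylLineClass.mult_lt`).

For that, move to the plane blown up in `s + 4` points. A Weyl line class has degree `1 + (r-1) D`;
send it to `β = N + D H - ∑ m_j p_j`, where `N` is the pencil `h - e_0`, the `p_j` are exceptional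
curves, and `H² = r - 1`, `H·N = 1`, `H·p_j = 0`. Transpositions and Cremona maps become reflections
in real roots (`exists_scroll`, `scrollClass_of_orbit`). The inequality becomes `m_j ≤ D`, that is,
`β·(N - p_j) ≥ 0`, where `N - p_j` is exceptional and `β·N = D > 0`. For `i = -1, 0, 1`, `β` is
respectively a real root, an exceptional class, or a class nonnegative on all exceptional classes.
Everything then rests on distinct exceptional classes meeting nonnegatively, which is a Coxeter-type
descent argument (`ReachIn.descend`, `ReachIn.eq_or_le`). -/

namespace WeylLines

/-! ### Orbits of dominant vectors under simply laced reflections. -/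

section Ascent

variable {V ι : Type*} [AddCommGroup V] (α : ι → V) (a : ι → V →ₗ[ℤ] ℤ)

/-- `x` is obtained from `ω` by applying `n` simple reflections `x ↦ x + a i x • α i`. -/
inductive ReachIn (ω : V) : ℕ → V → Prop
  | zero : ReachIn ω 0 ω
  | step {n : ℕ} {x : V} (i : ι) : ReachIn ω n x → ReachIn ω (n + 1) (x + a i x • α i)

variable {α a}
variable (hdiag : ∀ i, a i (α i) = -2)
  (hoff : ∀ i j, i ≠ j → (a i (α j) = 0 ∧ a j (α i) = 0) ∨ (a i (α j) = 1 ∧ a j (α i) = 1))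
  {ω : V} (hω : ∀ i, 0 ≤ a i ω)
include hdiag hoff hω

/-- In the orbit of a dominant vector, reflecting in a simple root on which the vector is negative
leads closer to the dominant vector. -/
theorem ReachIn.descend {n : ℕ} {y : V} (hy : ReachIn α a ω n y) {i : ι} (hi : a i y < 0) :
    ∃ m < n, ReachIn α a ω m (y + a i y • α i) := by
  induction n using Nat.strong_induction_on generalizing y i with
  | _ n ih =>
  cases hy with
  | zero => exact absurd hi (not_lt.mpr (hω i))
  | @step n z j hz =>
    rcases lt_trichotomy (a j z) 0 with hj | hj | hj
    -- The last reflection was itself a descent, so `y` has a shorter expression.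
    · obtain ⟨m, hm, hy'⟩ := ih n (Nat.lt_succ_self n) hz hj
      obtain ⟨k, hk, h⟩ := ih m (by omega) hy' hi
      exact ⟨k, by omega, h⟩
    · have hzy : z + a j z • α j = z := by simp [hj]
      rw [hzy] at hi ⊢
      obtain ⟨k, hk, h⟩ := ih n (Nat.lt_succ_self n) hz hi
      exact ⟨k, by omega, h⟩
    · by_cases hij : i = j
      · subst hij
        refine ⟨n, Nat.lt_succ_self n, ?_⟩
        convert hz using 1
        simp only [map_add, map_smul, hdiag, smul_eq_mul]
        module
      · rcases hoff i j hij with ⟨h1, h2⟩ | ⟨h1, h2⟩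
        · have hiz : a i z < 0 := by simpa [h1] using hi
          obtain ⟨m, hm, h⟩ := ih n (Nat.lt_succ_self n) hz hiz
          refine ⟨m + 1, by omega, ?_⟩
          convert h.step j using 1
          simp only [map_add, map_smul, h1, h2, smul_eq_mul]
          module
        -- Braid case: `z` descends along `i`, then along `j`, saving at least two steps; `s_i s_j z
        -- = s_j s_i (s_j s_i z)` spends them again.
        · have hi' : a i z + a j z < 0 := by simpa [h1] using hi
          obtain ⟨m, hm, h⟩ := ih n (Nat.lt_succ_self n) hz (i := i) (by omega)
          have hju : a j (z + a i z • α i) < 0 := by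
            simp only [map_add, map_smul, h2, smul_eq_mul]
            omega
          obtain ⟨k, hk, h'⟩ := ih m (by omega) h hju
          refine ⟨k + 2, by omega, ?_⟩
          convert (h'.step i).step j using 1
          simp only [map_add, map_smul, h1, h2, hdiag, smul_eq_mul]
          module

/-- The orbit of a dominant vector `ω` is obtained from `ω` by adding simple roots. -/
theorem ReachIn.eq_or_le {n : ℕ} {x : V} (hx : ReachIn α a ω n x) (f : V →ₗ[ℤ] ℤ)
    (hf : ∀ i, 0 ≤ f (α i)) : x = ω ∨ ∃ i, 0 < a i ω ∧ f ω + f (α i) ≤ f x := by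
  induction n using Nat.strong_induction_on generalizing x with
  | _ n ih =>
  cases hx with
  | zero => exact Or.inl rfl
  | @step n z j hz =>
    rcases lt_or_ge (a j z) 0 with hj | hj
    -- A downward step is replaced by a shorter expression; the remaining steps cannot decrease `f`.
    · obtain ⟨m, hm, h⟩ := hz.descend hdiag hoff hω hj
      exact ih m (by omega) h
    · have hle : f z ≤ f (z + a j z • α j) := by
        simp only [map_add, map_smul, smul_eq_mul]
        have := mul_nonneg hj (hf j)
        omega
      rcases ih n (Nat.lt_succ_self n) hz with rfl | ⟨i, hi, h⟩
      · rcases hj.eq_or_lt with hj | hj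
        · left
          simp [← hj]
        · refine Or.inr ⟨j, hj, ?_⟩
          simp only [map_add, map_smul, smul_eq_mul]
          nlinarith [hf j]
      · exact Or.inr ⟨i, hi, h.trans hle⟩

end Ascent

/-! ### Lattice, reflections and simple roots of a blown-up plane. -/

/-- The intersection form of the plane blown up in `n` points. -/
def planeForm (n : ℕ) : LinearMap.BilinForm ℤ (CurveClass n) :=
  LinearMap.mk₂ ℤ (fun x y => x.1 * y.1 - ∑ i, x.2 i * y.2 i)
    (fun x y z => by
      simp only [Prod.fst_add, Prod.snd_add, Pi.add_apply, add_mul, Finset.sum_add_distrib]; ring)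
    (fun k x y => by
      simp only [Prod.smul_fst, Prod.smul_snd, Pi.smul_apply, smul_eq_mul, mul_assoc,
        ← Finset.mul_sum]; ring)
    (fun x y z => by
      simp only [Prod.fst_add, Prod.snd_add, Pi.add_apply, mul_add, Finset.sum_add_distrib]; ring)
    (fun k x y => by
      simp only [Prod.smul_fst, Prod.smul_snd, Pi.smul_apply, smul_eq_mul, mul_left_comm _ k,
        ← Finset.mul_sum]; ring)

theorem planeForm_apply {n : ℕ} (x y : CurveClass n) :
    planeForm n x y = x.1 * y.1 - ∑ i, x.2 i * y.2 i := rfl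

theorem planeForm_comm {n : ℕ} (x y : CurveClass n) : planeForm n x y = planeForm n y x := by
  simp only [planeForm_apply, mul_comm]

@[simp] theorem planeForm_h_h (n : ℕ) : planeForm n (h n) (h n) = 1 := by
  simp [planeForm_apply, h]

@[simp] theorem planeForm_h_e {n : ℕ} (j : Fin n) : planeForm n (h n) (e j) = 0 := by
  simp [planeForm_apply, h, e]

@[simp] theorem planeForm_e_h {n : ℕ} (j : Fin n) : planeForm n (e j) (h n) = 0 := by
  simp [planeForm_apply, h, e]

@[simp] theorem planeForm_e_e {n : ℕ} (j k : Fin n) :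
    planeForm n (e j) (e k) = if j = k then -1 else 0 := by
  simp only [planeForm_apply, e, Pi.neg_apply, mul_zero, neg_mul_neg, Pi.single_apply, ite_mul,
    one_mul, zero_mul, Finset.sum_ite_eq', Finset.mem_univ, if_true]
  split_ifs <;> simp_all

/-- The map `x ↦ x + (x · ρ) ρ`, the reflection in `ρ` if `ρ² = -2`. -/
def reflect {n : ℕ} (ρ x : CurveClass n) : CurveClass n := x + planeForm n x ρ • ρ

theorem planeForm_reflect {n : ℕ} (ρ x y : CurveClass n) :
    planeForm n (reflect ρ x) y = planeForm n x (reflect ρ y) := by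
  simp only [reflect, map_add, map_smul, LinearMap.add_apply, LinearMap.smul_apply, smul_eq_mul,
    planeForm_comm ρ y]
  ring

theorem reflect_reflect {n : ℕ} {ρ : CurveClass n} (hρ : planeForm n ρ ρ = -2)
    (x : CurveClass n) : reflect ρ (reflect ρ x) = x := by
  simp only [reflect, map_add, map_smul, LinearMap.add_apply, LinearMap.smul_apply, smul_eq_mul, hρ]
  module

/-- Conjugation of reflections; it makes the set of roots stable under reflection. -/
theorem reflect_reflect_left {n : ℕ} {ρ : CurveClass n} (hρ : planeForm n ρ ρ = -2)
    (τ x : CurveClass n) : reflect (reflect ρ τ) x = reflect ρ (reflect τ (reflect ρ x)) := by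
  simp only [reflect, map_add, map_smul, LinearMap.add_apply, LinearMap.smul_apply, smul_eq_mul, hρ,
    planeForm_comm ρ τ]
  module

/-- The simple roots of the plane blown up in `n + 4` points. -/
def simpleRoot (n : ℕ) : Option (Fin (n + 3)) → CurveClass (n + 4)
  | none => h _ - e 0 - e 1 - e 2
  | some i => e i.castSucc - e i.succ

/-- The pairing with a simple root. -/
def simpleCoroot (n : ℕ) (i : Option (Fin (n + 3))) : CurveClass (n + 4) →ₗ[ℤ] ℤ :=
  planeForm _ (simpleRoot n i)

theorem simpleCoroot_self (n : ℕ) (i : Option (Fin (n + 3))) :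
    simpleCoroot n i (simpleRoot n i) = -2 := by
  cases i with
  | none => simp [simpleCoroot, simpleRoot, Fin.ext_iff, Nat.mod_eq_of_lt]
  | some i => simp [simpleCoroot, simpleRoot, Fin.ext_iff]

theorem simpleCoroot_comm (n : ℕ) (i j : Option (Fin (n + 3))) :
    simpleCoroot n i (simpleRoot n j) = simpleCoroot n j (simpleRoot n i) :=
  planeForm_comm _ _

theorem simpleCoroot_none_some (n : ℕ) (j : Fin (n + 3)) :
    simpleCoroot n none (simpleRoot n (some j)) = 0 ∨
      simpleCoroot n none (simpleRoot n (some j)) = 1 := by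
  have v1 : ((1 : Fin (n + 4)) : ℕ) = 1 := by simp
  have v2 : ((2 : Fin (n + 4)) : ℕ) = 2 := by simp [Nat.mod_eq_of_lt]
  simp only [simpleCoroot, simpleRoot, map_sub, LinearMap.sub_apply, planeForm_h_e, planeForm_e_e,
    Fin.ext_iff, Fin.val_castSucc, Fin.val_succ, Fin.val_zero, v1, v2]
  generalize (j : ℕ) = k
  rcases k with _ | _ | _ | k <;> simp

theorem simpleCoroot_of_ne (n : ℕ) {i j : Option (Fin (n + 3))} (hij : i ≠ j) :
    simpleCoroot n i (simpleRoot n j) = 0 ∨ simpleCoroot n i (simpleRoot n j) = 1 := by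
  rcases i with _ | i <;> rcases j with _ | j
  · exact absurd rfl hij
  · exact simpleCoroot_none_some n j
  · rw [simpleCoroot_comm]
    exact simpleCoroot_none_some n i
  · have : (i : ℕ) ≠ j := fun h => hij (by rw [Fin.ext h])
    simp only [simpleCoroot, simpleRoot, map_sub, LinearMap.sub_apply, planeForm_e_e,
      Fin.ext_iff, Fin.val_castSucc, Fin.val_succ]
    split_ifs <;> omega

/-! ### Exceptional classes and real roots. -/

/-- The exceptional classes: the orbit of the last exceptional curve. -/
def Exceptional {n : ℕ} (x : CurveClass (n + 4)) : Prop :=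
  ∃ k, ReachIn (simpleRoot n) (simpleCoroot n) (e (Fin.last (n + 3))) k x

theorem simpleCoroot_last (n : ℕ) (i : Option (Fin (n + 3))) :
    0 ≤ simpleCoroot n i (e (Fin.last (n + 3))) := by
  cases i with
  | none => simp [simpleCoroot, simpleRoot, Fin.ext_iff, Nat.mod_eq_of_lt]
  | some i =>
    have := i.2
    simp [simpleCoroot, simpleRoot, Fin.ext_iff]
    split_ifs <;> omega

/-- The last exceptional curve `E` is dominant. Leaving it adds a simple root `α` with `α·E ≥ 1`,
which compensates `E² = -1`. -/
theorem Exceptional.last_nonneg {n : ℕ} {x : CurveClass (n + 4)} (hx : Exceptional x)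
    (hne : x ≠ e (Fin.last (n + 3))) : 0 ≤ planeForm _ x (e (Fin.last (n + 3))) := by
  obtain ⟨k, hk⟩ := hx
  have hsym (i) : planeForm _ (e (Fin.last (n + 3))) (simpleRoot n i)
      = simpleCoroot n i (e (Fin.last (n + 3))) := planeForm_comm _ _
  have key := hk.eq_or_le (simpleCoroot_self n)
    (fun i j hij => by
      rw [simpleCoroot_comm n j i]
      simpa using simpleCoroot_of_ne n hij)
    (simpleCoroot_last n) (planeForm _ (e (Fin.last (n + 3))))
    (fun i => (hsym i).symm ▸ simpleCoroot_last n i)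
  obtain ⟨i, hi, hle⟩ := key.resolve_left hne
  rw [hsym] at hle
  rw [planeForm_comm]
  simp only [planeForm_e_e, if_true] at hle
  omega

/-- A real root: a class of square `-2` whose reflection preserves the exceptional classes. -/
structure IsRoot {n : ℕ} (ρ : CurveClass (n + 4)) : Prop where
  sq : planeForm _ ρ ρ = -2
  exceptional {x : CurveClass (n + 4)} : Exceptional x → Exceptional (reflect ρ x)

theorem isRoot_simpleRoot (n : ℕ) (i : Option (Fin (n + 3))) : IsRoot (simpleRoot n i) where
  sq := simpleCoroot_self n i
  exceptional := by
    rintro x ⟨k, hk⟩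
    refine ⟨k + 1, ?_⟩
    rw [reflect, planeForm_comm]
    exact hk.step i

theorem IsRoot.reflect {n : ℕ} {ρ τ : CurveClass (n + 4)} (hρ : IsRoot ρ) (hτ : IsRoot τ) :
    IsRoot (reflect ρ τ) where
  sq := by rw [planeForm_reflect, reflect_reflect hρ.sq, hτ.sq]
  exceptional hx := by
    rw [reflect_reflect_left hρ.sq]
    exact hρ.exceptional (hτ.exceptional (hρ.exceptional hx))

theorem IsRoot.neg {n : ℕ} {ρ : CurveClass (n + 4)} (hρ : IsRoot ρ) : IsRoot (-ρ) where
  sq := by simpa using hρ.sq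
  exceptional {x} hx := by
    convert hρ.exceptional hx using 1
    simp [WeylLines.reflect]

/-- The sum is the reflection of `ρ` in `τ`. -/
theorem IsRoot.add {n : ℕ} {ρ τ : CurveClass (n + 4)} (hρ : IsRoot ρ) (hτ : IsRoot τ)
    (hρτ : planeForm _ ρ τ = 1) : IsRoot (ρ + τ) := by
  convert hτ.reflect hρ using 1
  rw [WeylLines.reflect, hρτ, one_smul]

theorem isRoot_e_sub_e {n : ℕ} {a b : Fin (n + 4)} (hab : a ≠ b) : IsRoot (e a - e b) := by
  -- Telescope into consecutive simple roots; each new one pairs to `1` with the partial sum.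
  have key : ∀ (k : ℕ) (a b : Fin (n + 4)), (b : ℕ) = a + k + 1 → IsRoot (e a - e b) := by
    intro k
    induction k with
    | zero =>
      intro a b h
      convert isRoot_simpleRoot n (some ⟨a, by omega⟩) using 1
      simp only [simpleRoot]
      congr 2
      exact Fin.ext h
    | succ k ih =>
      intro a b h
      let c : Fin (n + 4) := ⟨a + k + 1, by omega⟩
      have h1 : IsRoot (e a - e c) := ih a c rfl
      have h2 : IsRoot (e c - e b) := by
        convert isRoot_simpleRoot n (some ⟨a + k + 1, by omega⟩) using 1
        simp only [simpleRoot]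
        congr 2
        exact Fin.ext h
      have hac : a ≠ c := fun h => by simp [c, Fin.ext_iff] at h; omega
      have hcb : c ≠ b := fun h' => by simp [c, Fin.ext_iff] at h'; omega
      have hab : a ≠ b := fun h' => by simp [Fin.ext_iff] at h'; omega
      convert h1.add h2 (by simp [hac, hcb, hab]) using 1
      abel
  rcases lt_or_gt_of_ne hab with h | h
  · exact key (b - a - 1) a b (by have : (a : ℕ) < b := h; omega)
  · convert (key (a - b - 1) b a (by have : (b : ℕ) < a := h; omega)).neg using 1
    abel

theorem exceptional_e {n : ℕ} (a : Fin (n + 4)) : Exceptional (e a) := by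
  have hlast : Exceptional (e (Fin.last (n + 3))) := ⟨0, .zero⟩
  by_cases ha : a = Fin.last (n + 3)
  · rwa [ha]
  · convert (isRoot_e_sub_e ha).exceptional hlast using 1
    simp [reflect, Ne.symm ha]

/-- An exceptional class meets every other exceptional curve nonnegatively. -/
theorem Exceptional.e_nonneg {n : ℕ} {x : CurveClass (n + 4)} (hx : Exceptional x)
    {a : Fin (n + 4)} (hne : x ≠ e a) : 0 ≤ planeForm _ x (e a) := by
  by_cases ha : a = Fin.last (n + 3)
  · subst ha
    exact hx.last_nonneg hne
  · have hρ := isRoot_e_sub_e ha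
    have hea : reflect (e a - e (Fin.last (n + 3))) (e (Fin.last (n + 3))) = e a := by
      simp [reflect, Ne.symm ha]
    rw [← hea, ← planeForm_reflect]
    refine (hρ.exceptional hx).last_nonneg fun h => hne ?_
    rw [← reflect_reflect hρ.sq x, h, hea]

/-! ### The pencil and its degenerate fibres. -/

/-- The class of the pencil of lines through the first point. -/
def pencil (n : ℕ) : CurveClass (n + 4) := h _ - e 0

/-- The exceptional classes that stand for the points of the blowup of `ℙ^r`. -/
def pt {n : ℕ} (j : Fin n) : CurveClass (n + 4) := e (j.addNat 4)

theorem addNat_four_ne {n : ℕ} (j : Fin n) (a : Fin (n + 4)) (ha : (a : ℕ) < 4) :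
    j.addNat 4 ≠ a := by
  intro h
  rw [← h] at ha
  simp at ha

/-- Add `e 1 - e b` and `e 2 - e c` to the simple root `h - e 0 - e 1 - e 2`. Index `3` stays
allowed, as an auxiliary point besides the `pt j`. -/
theorem isRoot_pencil_sub {n : ℕ} {b c : Fin (n + 4)} (hb : 2 < (b : ℕ)) (hc : 2 < (c : ℕ))
    (hbc : b ≠ c) : IsRoot (pencil n - e b - e c) := by
  have h0 := isRoot_simpleRoot n none
  simp only [simpleRoot] at h0
  have v1 : ((1 : Fin (n + 4)) : ℕ) = 1 := by simp
  have v2 : ((2 : Fin (n + 4)) : ℕ) = 2 := by simp [Nat.mod_eq_of_lt]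
  have v0 : ((0 : Fin (n + 4)) : ℕ) = 0 := by simp
  have b0 : 0 ≠ b := fun h => by rw [← h] at hb; omega
  have b1 : 1 ≠ b := fun h => by rw [← h] at hb; omega
  have b2 : 2 ≠ b := fun h => by rw [← h] at hb; omega
  have c0 : 0 ≠ c := fun h => by rw [← h] at hc; omega
  have c1 : 1 ≠ c := fun h => by rw [← h] at hc; omega
  have c2 : 2 ≠ c := fun h => by rw [← h] at hc; omega
  have e01 : (0 : Fin (n + 4)) ≠ 1 := fun h => by have := congrArg Fin.val h; omega
  have e02 : (0 : Fin (n + 4)) ≠ 2 := fun h => by have := congrArg Fin.val h; omega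
  have e12 : (1 : Fin (n + 4)) ≠ 2 := fun h => by have := congrArg Fin.val h; omega
  have h1 := h0.add (isRoot_e_sub_e b1) (by simp [b0, b1, b2, e01, e12.symm])
  have h2 := h1.add (isRoot_e_sub_e c2) (by simp [b2.symm, e02, e12, hbc, c0, c1, c2])
  convert h2 using 1
  rw [pencil]
  abel

@[simp] theorem planeForm_pencil_pencil (n : ℕ) : planeForm _ (pencil n) (pencil n) = 0 := by
  simp [pencil]

@[simp] theorem planeForm_pencil_pt {n : ℕ} (j : Fin n) : planeForm _ (pencil n) (pt j) = 0 := by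
  simp [pencil, pt, (addNat_four_ne j 0 (by simp)).symm]

@[simp] theorem planeForm_pt_pencil {n : ℕ} (j : Fin n) : planeForm _ (pt j) (pencil n) = 0 := by
  rw [planeForm_comm, planeForm_pencil_pt]

@[simp] theorem planeForm_pt_pt {n : ℕ} (j k : Fin n) :
    planeForm _ (pt j) (pt k) = if j = k then -1 else 0 := by
  simp [pt]

theorem isRoot_pt_sub_pt {n : ℕ} {j k : Fin n} (hjk : j ≠ k) : IsRoot (pt j - pt k) :=
  isRoot_e_sub_e (by simpa using hjk)

theorem isRoot_pencil_sub_pt {n : ℕ} {j k : Fin n} (hjk : j ≠ k) :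
    IsRoot (pencil n - pt j - pt k) :=
  isRoot_pencil_sub (by simp) (by simp) (by simpa using hjk)

/-- Moves the component `pencil n - pt j` of a degenerate fibre to the exceptional curve `e 3`,
where nonnegativity is known. -/
theorem exists_isRoot_reflect_eq {n : ℕ} (j : Fin n) :
    ∃ ρ : CurveClass (n + 4), IsRoot ρ ∧ reflect ρ (e 3) = pencil n - pt j := by
  have v3 : ((3 : Fin (n + 4)) : ℕ) = 3 := by simp [Nat.mod_eq_of_lt]
  have h3 := addNat_four_ne j 3 (by omega)
  have h0 : (0 : Fin (n + 4)) ≠ 3 := fun h => by have := congrArg Fin.val h; rw [v3] at this; simp at this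
  refine ⟨_, isRoot_pencil_sub (b := j.addNat 4) (c := 3) (by simp) (by omega) h3, ?_⟩
  simp [reflect, pencil, pt, h3.symm, h0.symm]

theorem exceptional_pencil_sub_pt {n : ℕ} (j : Fin n) : Exceptional (pencil n - pt j) := by
  obtain ⟨ρ, hρ, hρj⟩ := exists_isRoot_reflect_eq j
  exact hρj ▸ hρ.exceptional (exceptional_e 3)

theorem Exceptional.pencil_sub_pt_nonneg {n : ℕ} {x : CurveClass (n + 4)} (hx : Exceptional x)
    {j : Fin n} (hne : x ≠ pencil n - pt j) : 0 ≤ planeForm _ x (pencil n - pt j) := by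
  obtain ⟨ρ, hρ, hρj⟩ := exists_isRoot_reflect_eq j
  rw [← hρj, ← planeForm_reflect]
  refine (hρ.exceptional hx).e_nonneg fun h => hne ?_
  rw [← reflect_reflect hρ.sq x, h, hρj]

/-- The fibre class of the pencil is nef. -/
theorem Exceptional.pencil_nonneg {n : ℕ} {x : CurveClass (n + 4)} (hx : Exceptional x)
    (j : Fin n) : 0 ≤ planeForm _ x (pencil n) := by
  by_cases h1 : x = pt j
  · simp [h1]
  by_cases h2 : x = pencil n - pt j
  · simp [h2]
  -- The fibre splits as `(pencil n - pt j) + pt j`, a sum of two exceptional classes.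
  have h := add_nonneg (hx.pencil_sub_pt_nonneg h2) (hx.e_nonneg h1)
  rwa [← map_add, ← pt, sub_add_cancel] at h

/-- Pair up the points of `J` and add the roots `pencil n - pt a - pt b` one by one. Since the
pencil has square zero, the pairing with it stays `1`. -/
theorem IsRoot.add_pencil {n : ℕ} (k : ℕ) (J : Finset (Fin n)) (hJ : J.card = 2 * k)
    {v : CurveClass (n + 4)} (hv : IsRoot v) (hvN : planeForm _ v (pencil n) = 1)
    (hvJ : ∀ j ∈ J, planeForm _ v (pt j) = 0) :
    IsRoot (v + (k : ℤ) • pencil n - ∑ j ∈ J, pt j) := by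
  induction k generalizing J v with
  | zero =>
    obtain rfl : J = ∅ := by simpa using hJ
    simpa using hv
  | succ k ih =>
    obtain ⟨a, ha⟩ : J.Nonempty := Finset.card_pos.mp (by omega)
    have hcard := Finset.card_erase_of_mem ha
    obtain ⟨b, hb⟩ : (J.erase a).Nonempty := Finset.card_pos.mp (by omega)
    have hcard' := Finset.card_erase_of_mem hb
    have hba : b ≠ a := Finset.ne_of_mem_erase hb
    have hbJ : b ∈ J := Finset.mem_of_mem_erase hb
    have hv' := hv.add (isRoot_pencil_sub_pt hba.symm) (by simp [hvN, hvJ a ha, hvJ b hbJ])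
    convert ih ((J.erase a).erase b) (by omega) hv' (by simp [hvN]) ?_ using 1
    · rw [← Finset.add_sum_erase J _ ha, ← Finset.add_sum_erase (J.erase a) _ hb]
      push_cast
      module
    · intro j hj
      simp only [Finset.mem_erase] at hj
      simp [hvJ j hj.2.2, Ne.symm hj.1, Ne.symm hj.2.1]

/-! ### The scroll and the transfer of the Weyl action. -/

/-- The blowup of `ℙ^r` at `n` points is modelled on a ruled surface: `H` plays the role of a
hyperplane section of a rational normal scroll. -/
theorem exists_scroll (r n : ℕ) (hr : 1 ≤ r) : ∃ H : CurveClass (n + 4),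
    planeForm _ H H = (r : ℤ) - 1 ∧ planeForm _ H (pencil n) = 1 ∧
    (∀ j : Fin n, planeForm _ H (pt j) = 0) ∧
    ∀ I : Finset (Fin n), I.card = r + 1 → IsRoot (H - ∑ j ∈ I, pt j) := by
  have e01 : (0 : Fin (n + 4)) ≠ 1 := by simp
  have p0 (j : Fin n) := (addNat_four_ne j 0 (by simp)).symm
  have p1 (j : Fin n) := (addNat_four_ne j 1 (by simp)).symm
  have N0 : planeForm (n + 4) (e 0) (pencil n) = 1 := by simp [pencil]
  have N1 : planeForm (n + 4) (e 1) (pencil n) = 0 := by simp [pencil, e01.symm]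
  have N0' : planeForm (n + 4) (pencil n) (e 0) = 1 := by rw [planeForm_comm, N0]
  have N1' : planeForm (n + 4) (pencil n) (e 1) = 0 := by rw [planeForm_comm, N1]
  have P0 (j : Fin n) : planeForm (n + 4) (e 0) (pt j) = 0 := by simp [pt, p0 j]
  have P1 (j : Fin n) : planeForm (n + 4) (e 1) (pt j) = 0 := by simp [pt, p1 j]
  obtain ⟨k, rfl | rfl⟩ := r.even_or_odd'
  -- Even `r = 2k`: `H² = -1 + 2k`. As `|I|` is odd, one point goes into the starting root `e 0 - pt
  -- a`.
  · refine ⟨e 0 + (k : ℤ) • pencil n, ?_, ?_, fun j => ?_, fun I hI => ?_⟩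
    · simp [-natCast_zsmul, -zsmul_eq_mul, N0, N0']; ring
    · simp [-natCast_zsmul, -zsmul_eq_mul, N0]
    · simp [-natCast_zsmul, -zsmul_eq_mul, P0]
    · obtain ⟨a, ha⟩ : I.Nonempty := Finset.card_pos.mp (by omega)
      have hcard := Finset.card_erase_of_mem ha
      convert IsRoot.add_pencil k (I.erase a) (by omega) (isRoot_e_sub_e (p0 a))
        (by simp [N0, ← pt.eq_1]) ?_ using 1
      · rw [← Finset.add_sum_erase I _ ha, pt]
        module
      · intro j hj
        rw [← pt]
        simp [P0, (Finset.ne_of_mem_erase hj).symm]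
  -- Odd `r = 2k + 1`: subtracting `e 1` corrects the parity of `H²`, and all of `I` is paired up
  -- from `e 0 - e 1`.
  · refine ⟨e 0 + ((k + 1 : ℕ) : ℤ) • pencil n - e 1, ?_, ?_, fun j => ?_, fun I hI => ?_⟩
    · simp [-zsmul_eq_mul, N0, N0', N1, N1', e01, e01.symm]; ring
    · simp [-zsmul_eq_mul, N0, N1]
    · simp [-zsmul_eq_mul, P0, P1]
    · convert IsRoot.add_pencil (k + 1) I (by omega) (isRoot_e_sub_e e01)
        (by simp [N0, N1]) (fun j _ => by simp [P0, P1]) using 1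
      module

section Scroll

variable {n : ℕ} (H : CurveClass (n + 4))

/-- The class on the scroll that corresponds to a curve class of degree `1 + (r - 1) D` with
multiplicities `m`. -/
def scrollClass (D : ℤ) (m : Fin n → ℤ) : CurveClass (n + 4) :=
  pencil n + D • H - ∑ j, m j • pt j

variable {H}

theorem scrollClass_pencil (hN : planeForm _ H (pencil n) = 1) (D : ℤ) (m : Fin n → ℤ) :
    planeForm _ (scrollClass H D m) (pencil n) = D := by
  simp [-zsmul_eq_mul, scrollClass, hN]

theorem scrollClass_pt (hpt : ∀ j, planeForm _ H (pt j) = 0) (D : ℤ) (m : Fin n → ℤ) (j : Fin n) :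
    planeForm _ (scrollClass H D m) (pt j) = m j := by
  simp [-zsmul_eq_mul, scrollClass, hpt]

theorem scrollClass_add_add (D t : ℤ) (m v : Fin n → ℤ) :
    scrollClass H (D + t) (m + v) = scrollClass H D m + t • H - ∑ j, v j • pt j := by
  simp only [scrollClass, Pi.add_apply, add_smul, Finset.sum_add_distrib]
  abel

theorem reflect_scrollClass_swap (hpt : ∀ j, planeForm _ H (pt j) = 0) (D : ℤ) (m : Fin n → ℤ)
    (a b : Fin n) :
    reflect (pt a - pt b) (scrollClass H D m) = scrollClass H D (m ∘ Equiv.swap a b) := by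
  have hm : m ∘ Equiv.swap a b = m + (Pi.single a (m b - m a) + Pi.single b (m a - m b)) := by
    ext j
    simp only [Function.comp_apply, Pi.add_apply, Pi.single_apply, Equiv.swap_apply_def]
    split_ifs <;> subst_vars <;> ring_nf
  have h := scrollClass_add_add (H := H) D 0 m (Pi.single a (m b - m a) + Pi.single b (m a - m b))
  rw [add_zero] at h
  rw [hm, h, reflect]
  simp only [map_sub, scrollClass_pt hpt, Pi.add_apply, add_smul, Finset.sum_add_distrib,
    Pi.single_apply, ite_smul, zero_smul, Finset.sum_ite_eq', Finset.mem_univ, if_true]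
  module

theorem reflect_scrollClass_cremona {r : ℕ} (hH : planeForm _ H H = (r : ℤ) - 1)
    (hN : planeForm _ H (pencil n) = 1) (hpt : ∀ j, planeForm _ H (pt j) = 0) (D : ℤ)
    (m : Fin n → ℤ) (I : Finset (Fin n)) :
    let t := 1 + ((r : ℤ) - 1) * D - ∑ i ∈ I, m i
    reflect (H - ∑ j ∈ I, pt j) (scrollClass H D m)
      = scrollClass H (D + t) (fun j => if j ∈ I then m j + t else m j) := by
  intro t
  have hm : (fun j => if j ∈ I then m j + t else m j) = m + (fun j => if j ∈ I then t else 0) := by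
    ext j
    simp only [Pi.add_apply]
    split_ifs <;> simp
  have hHt : planeForm _ (scrollClass H D m) (H - ∑ j ∈ I, pt j) = t := by
    have : planeForm _ (scrollClass H D m) H = 1 + ((r : ℤ) - 1) * D := by
      simp [-zsmul_eq_mul, scrollClass, hH, planeForm_comm (pencil n) H, hN, planeForm_comm (pt _) H,
        hpt, mul_comm]
    rw [map_sub, map_sum, this]
    simp only [scrollClass_pt hpt, t]
  rw [hm, scrollClass_add_add, reflect, hHt]
  simp only [ite_smul, zero_smul, Finset.sum_ite_mem, Finset.univ_inter, smul_sub, Finset.smul_sum]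
  abel

end Scroll

theorem weylGroup_induction {r s : ℕ} {P : CurveClass s → Prop}
    (swap : ∀ c a b, a ≠ b → P c → P (permAct (Equiv.swap a b) c))
    (crem : ∀ c I (hI : I.card = r + 1), P c → P (cremona r I hI c))
    {w : CurveClass s ≃ₗ[ℤ] CurveClass s} (hw : w ∈ weylGroup r s) {c : CurveClass s} (hc : P c) :
    P (w c) := by
  have perm (σ : Equiv.Perm (Fin s)) : ∀ c, P c → P (permAct σ c) := by
    induction σ using Equiv.Perm.swap_induction_on with
    | one => exact fun c hc => hc
    | swap_mul σ a b hab ih => exact fun c hc => swap _ a b hab (ih c hc)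
  have inv (I : Finset (Fin s)) (hI : I.card = r + 1) : (cremona r I hI)⁻¹ = cremona r I hI := rfl
  induction hw using Subgroup.closure_induction'' generalizing c with
  | mem x hx =>
    rcases hx with ⟨σ, rfl⟩ | ⟨I, hI, rfl⟩
    · exact perm σ c hc
    · exact crem c I hI hc
  | inv_mem x hx =>
    rcases hx with ⟨σ, rfl⟩ | ⟨I, hI, rfl⟩
    · exact perm σ⁻¹ c hc
    · rw [inv]
      exact crem c I hI hc
  | one => exact hc
  | mul x y _ _ hx hy => exact hx (hy hc)

theorem lineThrough_eq {s : ℕ} (T : Finset (Fin s)) :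
    lineThrough T = (1, fun j => if j ∈ T then 1 else 0) := by
  ext j
  · simp [lineThrough, h, e, Prod.fst_sum]
  · simp [lineThrough, h, e, Prod.snd_sum, Finset.sum_apply, Pi.single_apply]

theorem scrollClass_line {n : ℕ} (H : CurveClass (n + 4)) (T : Finset (Fin n)) :
    scrollClass H 0 (fun j => if j ∈ T then 1 else 0) = pencil n - ∑ j ∈ T, pt j := by
  simp [scrollClass]

/-- A property of the classes on the scroll that is invariant under reflections passes from a line
to all classes in its Weyl orbit. -/
theorem scrollClass_of_orbit {r s : ℕ} {H : CurveClass (s + 4)}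
    (hH : planeForm _ H H = (r : ℤ) - 1) (hN : planeForm _ H (pencil s) = 1)
    (hpt : ∀ j, planeForm _ H (pt j) = 0)
    (hroot : ∀ I : Finset (Fin s), I.card = r + 1 → IsRoot (H - ∑ j ∈ I, pt j))
    {P : CurveClass (s + 4) → Prop} (hP : ∀ ρ x, IsRoot ρ → P x → P (reflect ρ x))
    {T : Finset (Fin s)} (hT : P (pencil s - ∑ j ∈ T, pt j))
    {w : CurveClass s ≃ₗ[ℤ] CurveClass s} (hw : w ∈ weylGroup r s) :
    ∃ D : ℤ, deg (w (lineThrough T)) = 1 + ((r : ℤ) - 1) * D ∧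
      P (scrollClass H D (mult (w (lineThrough T)))) := by
  refine weylGroup_induction
    (P := fun c => ∃ D : ℤ, deg c = 1 + ((r : ℤ) - 1) * D ∧ P (scrollClass H D (mult c)))
    ?_ ?_ hw ?_
  · rintro c a b hab ⟨D, hD, hc⟩
    refine ⟨D, hD, ?_⟩
    have := hP _ _ (isRoot_pt_sub_pt hab) hc
    rwa [reflect_scrollClass_swap hpt] at this
  · rintro c I hI ⟨D, hD, hc⟩
    refine ⟨D + (1 + ((r : ℤ) - 1) * D - ∑ i ∈ I, mult c i), ?_, ?_⟩
    · change deg c + ((r : ℤ) - 1) * (deg c - ∑ i ∈ I, mult c i) = _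
      rw [hD]
      ring
    · have := hP _ _ (hroot I hI) hc
      rw [reflect_scrollClass_cremona hH hN hpt, ← hD] at this
      rwa [← hD]
  · refine ⟨0, by simp [lineThrough_eq, deg], ?_⟩
    rw [lineThrough_eq]
    change P (scrollClass H 0 (fun j => if j ∈ T then 1 else 0))
    rwa [scrollClass_line]

/-- The multiplicities of a Weyl line class of degree greater than one. -/
theorem IsWeylLineClass.mult_lt {r s : ℕ} (hr : 2 ≤ r) {i : ℤ} (hi : i = -1 ∨ i = 0 ∨ i = 1)
    {c : CurveClass s} (hc : IsWeylLineClass r s i c) (hd : 1 < deg c) (j : Fin s) :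
    ((r : ℤ) - 1) * mult c j < deg c := by
  obtain ⟨T, hT, w, hw, rfl⟩ := hc
  obtain ⟨H, hH, hN, hpt, hroot⟩ := exists_scroll r s (by omega)
  have hr' : (0 : ℤ) < (r : ℤ) - 1 := by omega
  suffices key : ∃ D : ℤ, deg (w (lineThrough T)) = 1 + ((r : ℤ) - 1) * D ∧
      (0 < D → 0 ≤ planeForm _ (scrollClass H D (mult (w (lineThrough T)))) (pencil s - pt j)) by
    obtain ⟨D, hD, hnonneg⟩ := key
    have hD0 : 0 < D := by
      rw [hD] at hd
      exact pos_of_mul_pos_right (by linarith) hr'.le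
    have h := hnonneg hD0
    rw [map_sub, scrollClass_pencil hN, scrollClass_pt hpt] at h
    rw [hD]
    linarith [mul_nonneg hr'.le h]
  rcases hi with rfl | rfl | rfl
  · obtain ⟨a, b, hab, rfl⟩ := Finset.card_eq_two.mp (by omega : T.card = 2)
    obtain ⟨D, hD, hβ⟩ := scrollClass_of_orbit hH hN hpt hroot (P := IsRoot)
      (fun ρ x hρ hx => hρ.reflect hx) (T := {a, b})
      (by rw [Finset.sum_pair hab, ← sub_sub]; exact isRoot_pencil_sub_pt hab) hw
    refine ⟨D, hD, fun hD0 => ?_⟩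
    -- For `E = pencil s - pt j`, the reflected class `E + (E·β) β` is exceptional and meets the
    -- pencil in `(E·β) D`, so `D > 0` forces `E·β ≥ 0`.
    have h := (hβ.exceptional (exceptional_pencil_sub_pt j)).pencil_nonneg j
    rw [planeForm_comm _ (pencil s), reflect, map_add, map_smul, smul_eq_mul,
      planeForm_comm _ (scrollClass _ _ _), planeForm_comm (pencil s) (scrollClass _ _ _),
      scrollClass_pencil hN] at h
    simp only [map_sub, planeForm_pencil_pencil, planeForm_pencil_pt, sub_zero, zero_add] at h ⊢
    exact nonneg_of_mul_nonneg_left h hD0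
  · obtain ⟨a, rfl⟩ := Finset.card_eq_one.mp (by omega : T.card = 1)
    obtain ⟨D, hD, hβ⟩ := scrollClass_of_orbit hH hN hpt hroot (P := Exceptional)
      (fun ρ x hρ hx => hρ.exceptional hx) (T := {a})
      (by rw [Finset.sum_singleton]; exact exceptional_pencil_sub_pt a) hw
    -- Equality with `pencil s - pt j`, which is orthogonal to the pencil, would give `D = 0`.
    refine ⟨D, hD, fun hD0 => hβ.pencil_sub_pt_nonneg fun h => hD0.ne' ?_⟩
    rw [← scrollClass_pencil hN D, h]
    simp
  · obtain rfl := Finset.card_eq_zero.mp (by omega : T.card = 0)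
    obtain ⟨D, hD, hβ⟩ := scrollClass_of_orbit hH hN hpt hroot
      (P := fun β => ∀ x, Exceptional x → 0 ≤ planeForm _ β x)
      (fun ρ x hρ hx y hy => by rw [planeForm_reflect]; exact hx _ (hρ.exceptional hy)) (T := ∅)
      (fun x hx => by
        rw [Finset.sum_empty, sub_zero, planeForm_comm]; exact hx.pencil_nonneg j) hw
    exact ⟨D, hD, fun _ => hβ _ (exceptional_pencil_sub_pt j)⟩

/-! ### Weyl invariance of the form and of `F`. -/

theorem bilin_weylGroup (r : ℕ) {s : ℕ} {w : CurveClass s ≃ₗ[ℤ] CurveClass s}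
    (hw : w ∈ weylGroup r s) (x y : CurveClass s) : bilin r (w x) (w y) = bilin r x y := by
  induction hw using Subgroup.closure_induction generalizing x y with
  | mem g hg =>
    rcases hg with ⟨σ, rfl⟩ | ⟨I, hI, rfl⟩
    · have : ∑ i, x.2 (σ.symm i) * y.2 (σ.symm i) = ∑ i, x.2 i * y.2 i :=
        Equiv.sum_comp σ.symm fun i => x.2 i * y.2 i
      change x.1 * y.1 - ((r : ℤ) - 1) * ∑ i, x.2 (σ.symm i) * y.2 (σ.symm i) = _
      rw [this]
      rfl
    · obtain ⟨d, m⟩ := x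
      obtain ⟨d', m'⟩ := y
      have key (t t' : ℤ) : ∑ i, (if i ∈ I then m i + t else m i) * (if i ∈ I then m' i + t' else m' i)
          = ∑ i, m i * m' i + t' * ∑ i ∈ I, m i + t * ∑ i ∈ I, m' i + (r + 1) * t * t' := by
        have h1 (i : Fin s) :
            (if i ∈ I then m i + t else m i) * (if i ∈ I then m' i + t' else m' i)
              = m i * m' i + if i ∈ I then t' * m i + t * m' i + t * t' else 0 := by
          split_ifs <;> ring
        simp only [h1, Finset.sum_add_distrib, Finset.sum_ite_mem, Finset.univ_inter,
          ← Finset.mul_sum, Finset.sum_const, hI]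
        ring
      change (d + ((r : ℤ) - 1) * (d - ∑ i ∈ I, m i)) * (d' + ((r : ℤ) - 1) * (d' - ∑ i ∈ I, m' i))
        - ((r : ℤ) - 1) * ∑ i, (if i ∈ I then m i + (d - ∑ i ∈ I, m i) else m i)
          * (if i ∈ I then m' i + (d' - ∑ i ∈ I, m' i) else m' i)
        = d * d' - ((r : ℤ) - 1) * ∑ i, m i * m' i
      rw [key]
      ring
  | one => rfl
  | mul g g' _ _ hg hg' => exact (hg _ _).trans (hg' x y)
  | inv g _ hg =>
    rw [← hg]
    exact congrArg₂ (bilin r) (g.apply_symm_apply x) (g.apply_symm_apply y)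

theorem F_eq (r s : ℕ) : F r s = ((r : ℤ) + 1, fun _ => 1) := by
  ext j
  · simp [F, h, e, Prod.fst_sum]
  · simp [F, h, e, Prod.snd_sum, Finset.sum_apply, Pi.single_apply]

theorem weylGroup_F {r s : ℕ} {w : CurveClass s ≃ₗ[ℤ] CurveClass s} (hw : w ∈ weylGroup r s) :
    w (F r s) = F r s := by
  rw [F_eq]
  refine weylGroup_induction (P := fun c => c = ((r : ℤ) + 1, fun _ => 1)) ?_ ?_ hw rfl
  · rintro _ a b - rfl
    rfl
  · rintro _ I hI rfl
    have ht : ((r : ℤ) + 1) - ∑ i ∈ I, (1 : ℤ) = 0 := by simp [hI]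
    change (((r : ℤ) + 1) + ((r : ℤ) - 1) * (((r : ℤ) + 1) - ∑ i ∈ I, (1 : ℤ)),
      fun i => if i ∈ I then (1 : ℤ) + (((r : ℤ) + 1) - ∑ i ∈ I, (1 : ℤ)) else 1) = _
    simp only [ht, mul_zero, add_zero, ite_self]

theorem bilin_h_sub_e (r : ℕ) {s : ℕ} (c : CurveClass s) (j : Fin s) :
    bilin r c (h s - e j) = deg c - ((r : ℤ) - 1) * mult c j := by
  simp [bilin, deg, mult, h, e, Pi.single_apply]

end WeylLines

theorem mainTheorem11 (r s : ℕ) (hr : 2 ≤ r) (i : ℤ) (hi : i = -1 ∨ i = 0 ∨ i = 1)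
    (c : WeylLines.CurveClass s) (hc : WeylLines.IsWeylLineClass r s i c) :
    WeylLines.IsNumericalWeylLineClass r s i c := by
  open WeylLines in
  have hc' := hc
  obtain ⟨T, hT, v, hv, rfl⟩ := hc'
  refine ⟨?_, ?_, fun w hw hd j => ?_⟩
  · conv_lhs => rw [← weylGroup_F hv]
    rw [bilin_weylGroup r hv, lineThrough_eq, F_eq]
    simp only [bilin, deg, mult, mul_one, Finset.sum_ite_mem, Finset.univ_inter, Finset.sum_const,
      nsmul_eq_mul, hT]
    ring
  · rw [bilin_weylGroup r hv, lineThrough_eq]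
    simp only [bilin, deg, mult, mul_one, mul_ite, mul_zero, Finset.sum_ite_mem,
      Finset.univ_inter, Finset.sum_const, nsmul_eq_mul]
    simp [hT]
    ring
  · have hmem := inv_mem hw
    have hwc : IsWeylLineClass r s i (w⁻¹ (v (lineThrough T))) :=
      ⟨T, hT, w⁻¹ * v, mul_mem hmem hv, rfl⟩
    have hlt := hwc.mult_lt hr hi hd j
    rw [← bilin_weylGroup r hmem, show w⁻¹ (w (h s - e j)) = h s - e j from
      w.symm_apply_apply _, bilin_h_sub_e]
    omega
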